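/- Let $d\ge 2$ and $n\ge 1$ be integers and $\omega=e^{2\pi i/d}$. Consider $n$ qudits with computational bases $\{|q\rangle\}_{q\in\mathbb Z_d}$. For a set $e$ of qudits let $Z_e$ be the controlled phase gate $Z_e|x\rangle=\omega^{\prod_{i\in e}x_i}|x\rangle$, and let $|+\rangle=d^{-1/2}\sum_{q}|q\rangle$. A multi-hypergraph $H$ on $V=\{1,\dots,n\}$ assigns to each subset $e\subseteq V$ a multiplicity $m_e\in\mathbb Z_d$ with $m_\emptyset=0$; its hyperedges are the $e$ with $m_e\neq 0$, and its hypergraph state is $|H\rangle=\prod_e Z_e^{m_e}|+\rangle^{\otimes V}$. For $\mu\in\mathbb Z_d$ let $|G_\kappa^\mu\rangle=Z_{W}^{\mu}|+\rangle^{\otimes W}$, $|W|=\kappa$, be the elementary hypergraph state on $\kappa$ qudits. Suppose that $H$ is connected (any two vertices are joined by a chain of hyperedges, consecutive ones intersecting), let $k_{\max}$ be the largest cardinality of a hyperedge of $H$, and let $V=A\sqcup B$ be a bipartition with $A$ and $B$ non-empty. Then there is a finite adaptive protocol (each step may depend on earlier measurement outcomes), consisting only of single-qudit measurements in the $Z$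 (computational) basis and of unitaries $U_A\otimes U_B$ that are local with respect to $AB$, which transforms $|H\rangle$, for every sequence of measurement outcomes of nonzero probability, into a state of the form $$|G_\kappa^\mu\rangle\,|q_1\rangle|q_2\rangle\cdots|q_{n-\kappa}\rangle,\qquad 2\le\kappa\le k_{\max},\quad \mu\in\mathbb Z_d\setminus\{0\},$$ where $|G_\kappa^\mu\rangle$ occupies a set of $\kappa$ qudits that meets both $A$ and $B$ and each of the remaining $n-\kappa$ qudits is in a computational basis state $|q_i\rangle$. Here $\kappa$, $\mu$, the set of qudits and the $q_i$ may depend on the measurement outcomes. -/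

import Mathlib

open scoped BigOperators

noncomputable section

/-- A multi-hypergraph on the vertex set `V` for qudits of dimension `d`: every subset of `V`
carries a multiplicity in `ℤ/d`, and the hyperedges are the subsets with nonzero multiplicity.
Hyperedges are non-empty. -/
structure MultiHypergraph (d : ℕ) (V : Type*) where
  mult : Finset V → ZMod d
  mult_empty : mult ∅ = 0

namespace MultiHypergraph

variable {d : ℕ} {V : Type*}

/-- `e` is a hyperedge of `H`. -/
def IsEdge (H : MultiHypergraph d V) (e : Finset V) : Prop := H.mult e ≠ 0

/-- The graph in which two distinct vertices are adjacent when they share a hyperedge. -/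
def adjGraph (H : MultiHypergraph d V) : SimpleGraph V where
  Adj u v := u ≠ v ∧ ∃ e, H.IsEdge e ∧ u ∈ e ∧ v ∈ e
  symm := ⟨fun _ _ h => ⟨h.1.symm, h.2.imp fun _ he => ⟨he.1, he.2.2, he.2.1⟩⟩⟩
  loopless := ⟨fun _ h => h.1 rfl⟩

/-- Any two vertices are joined by a chain of hyperedges. -/
def IsConnected (H : MultiHypergraph d V) : Prop := H.adjGraph.Connected

open Classical in
/-- The largest cardinality of a hyperedge (`0` if there are no hyperedges). -/
def maxCard [Fintype V] (H : MultiHypergraph d V) : ℕ :=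
  (Finset.univ.filter fun e : Finset V => H.IsEdge e).sup Finset.card

end MultiHypergraph

namespace Qudit

/-- The Hilbert space of qudits of dimension `d` labelled by `V`; the computational basis is
indexed by the strings `V → ℤ/d`. -/
abbrev Space (d : ℕ) (V : Type*) := EuclideanSpace ℂ (V → ZMod d)

variable {d : ℕ} [NeZero d] {V : Type*} [Fintype V] [DecidableEq V]

/-- The linear operator given by a matrix in the computational basis, applied to a vector. -/
def act (M : Matrix (V → ZMod d) (V → ZMod d) ℂ) (ψ : Space d V) : Space d V :=
  Matrix.toEuclideanLin M ψ

/-- The vector `|+⟩^V`, all of whose amplitudes are `d^{-|V|/2}`. -/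
def plus (d : ℕ) [NeZero d] (V : Type*) [Fintype V] : Space d V :=
  WithLp.toLp 2 fun _ => ((Real.sqrt d : ℂ)⁻¹) ^ Fintype.card V

/-- The diagonal of the controlled phase gate `Z_e`: the entry at the string `x` is
`ω ^ (∏ i ∈ e, x i)` with `ω = exp (2πi/d)`. -/
def phase (e : Finset V) (x : V → ZMod d) : ℂ := ZMod.stdAddChar (∏ i ∈ e, x i)

/-- The hypergraph state `∏ₑ Z_e^{m_e} |+⟩^V`. The gates are diagonal, so that their product is the
diagonal operator whose diagonal is the pointwise product. -/
def hypergraphState (H : MultiHypergraph d V) : Space d V :=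
  act (Matrix.diagonal (∏ e : Finset V, phase e ^ (H.mult e).val)) (plus d V)

/-- The elementary hypergraph state `Z_V^μ |+⟩^V`, with the single hyperedge `V`. -/
def elementaryState (V : Type*) [Fintype V] [DecidableEq V] (μ : ZMod d) : Space d V :=
  act (Matrix.diagonal (phase Finset.univ ^ μ.val)) (plus d V)

/-- The product of a vector `φ` of the qudits in `e` with the computational basis
states `|q i⟩` of the qudits `i ∉ e`. -/
def tensorBasis (e : Finset V) (φ : Space d e) (q : V → ZMod d) : Space d V :=
  WithLp.toLp 2 fun x =>
    φ (fun i => x i) * ∏ i ∈ eᶜ, (if x i = q i then 1 else 0)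

/-- The set `e` of qudits is crossed by the bipartition with parts `A` and `Aᶜ`. -/
def Crosses (A e : Finset V) : Prop := (e ∩ A).Nonempty ∧ (e ∩ Aᶜ).Nonempty

/-- `U = U_A ⊗ U_B` for unitaries `U_A` on the qudits in `A` and `U_B` on those in `B = Aᶜ`. -/
def IsLocalUnitary (A : Finset V) (U : Matrix (V → ZMod d) (V → ZMod d) ℂ) : Prop :=
  ∃ UA ∈ Matrix.unitaryGroup ({i // i ∈ A} → ZMod d) ℂ,
  ∃ UB ∈ Matrix.unitaryGroup ({i // i ∈ Aᶜ} → ZMod d) ℂ,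
    ∀ x y : V → ZMod d,
      U x y = UA (fun i => x i) (fun i => y i) * UB (fun i => x i) (fun i => y i)

/-- The projector onto the subspace in which qudit `k` is in the basis state `|q⟩`. -/
def proj (k : V) (q : ZMod d) : Matrix (V → ZMod d) (V → ZMod d) ℂ :=
  Matrix.diagonal fun x => if x k = q then 1 else 0

/-- The normalized state after a measurement of qudit `k` in the `Z` basis with outcome `q`
(meaningful if the outcome has positive probability, `act (proj k q) ψ ≠ 0`). -/
def postMeasurement (k : V) (q : ZMod d) (ψ : Space d V) : Space d V :=
  ((‖act (proj k q) ψ‖⁻¹ : ℝ) : ℂ) • act (proj k q) ψ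

/-- `Reduces A T ψ`: some finite adaptive protocol, made of unitaries that are local with respect
to the bipartition with parts `A` and `Aᶜ` and of single-qudit measurements in the `Z` basis,
takes `ψ` to a state in `T`, whatever the outcomes of the measurements. Later steps may depend on
earlier outcomes. -/
inductive Reduces (A : Finset V) (T : Set (Space d V)) : Space d V → Prop
  | done (ψ : Space d V) : ψ ∈ T → Reduces A T ψ
  | unitary (ψ : Space d V) (U : Matrix (V → ZMod d) (V → ZMod d) ℂ) :
      IsLocalUnitary A U → Reduces A T (act U ψ) → Reduces A T ψ
  | measure (ψ : Space d V) (k : V) :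
      (∀ q : ZMod d, act (proj k q) ψ ≠ 0 → Reduces A T (postMeasurement k q ψ)) →
      Reduces A T ψ

/-- The states `|G_κ^μ⟩ |q₁⟩ ⋯ |q_{n-κ}⟩` with `2 ≤ κ ≤ K` and `μ ≠ 0`, where the elementary
hypergraph state occupies a set of `κ` qudits crossed by the bipartition. -/
def elementaryTargets (A : Finset V) (K : ℕ) : Set (Space d V) :=
  {ψ | ∃ (κ : ℕ) (μ : ZMod d) (e : Finset V) (q : V → ZMod d),
    2 ≤ κ ∧ κ ≤ K ∧ μ ≠ 0 ∧ e.card = κ ∧ Crosses A e ∧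
      ψ = tensorBasis e (elementaryState {i // i ∈ e} μ) q}

end Qudit

end

/-!
The protocol keeps a set `S` of active qudits in a state with equal weights whose phases are given
by a multilinear polynomial over `ℤ/d`, one of its monomials being crossed by the bipartition; the
other qudits are in basis states. It deactivates active qudits one at a time by measuring them.

Measuring `v` with outcome `r` substitutes `x v = r`, which turns the coefficient `m g` of a
monomial `g` avoiding `v` into `m g + r * m (insert v g)`. Hence `v` is safe to measure if this
never vanishes for some crossed `g`. Take for `g` a maximal crossed monomial other than `S`, and
`v ∈ S \ g`. If `insert v g ≠ S`, the coefficient at `insert v g` is zero by maximality and `v` is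
safe. If `g = S \ {v}`, the equation `m g + r * m S = 0` could have a solution `r`; but then the
local shift `x v ↦ x v + r` deletes the monomial `g` beforehand. When `S` is the only crossed
monomial left, all the others are removed by phases local to one side.
-/

noncomputable section

namespace Qudit

section Polynomial

variable {R : Type*} [CommSemiring R] {V : Type*} [Fintype V] [DecidableEq V]

/-- The value at `x` of the multilinear polynomial with coefficient `m e` at the monomial
`∏ i ∈ e, x i`. A hypergraph state is described by such a polynomial in the exponent, with the
hyperedges as monomials. -/
def multilinearEval (m : Finset V → R) (x : V → R) : R :=
  ∑ e, m e * ∏ i ∈ e, x i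

/-- The coefficients of the multilinear polynomial obtained by the substitution `x ↦ x + t`: its
Taylor expansion at `t`. -/
def shiftCoeff (t : V → R) (m : Finset V → R) (e : Finset V) : R :=
  ∑ f with e ⊆ f, m f * ∏ i ∈ f \ e, t i

/-- The coefficients of the multilinear polynomial obtained by the substitution `x v ↦ r`, in which
the variable `x v` no longer occurs. -/
def restrictCoeff (v : V) (r : R) (m : Finset V → R) (e : Finset V) : R :=
  if v ∈ e then 0 else m e + r * m (insert v e)

omit [DecidableEq V] in
lemma multilinearEval_add (m m' : Finset V → R) :
    multilinearEval (m + m') = multilinearEval m + multilinearEval m' := by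
  ext x
  simp only [multilinearEval, Pi.add_apply, add_mul, Finset.sum_add_distrib]

lemma multilinearEval_single (S : Finset V) (c : R) (x : V → R) :
    multilinearEval (Pi.single S c) x = c * ∏ i ∈ S, x i := by
  simp [multilinearEval, Pi.single_apply]

omit [DecidableEq V] in
lemma dependsOn_multilinearEval {A : Finset V} {m : Finset V → R}
    (hm : ∀ e, m e ≠ 0 → e ⊆ A) : DependsOn (multilinearEval m) (A : Set V) := by
  refine fun x y hxy => Finset.sum_congr rfl fun e _ => ?_
  by_cases he : m e = 0
  · simp only [he, zero_mul]
  · rw [Finset.prod_congr rfl fun i hi => hxy i (hm e he hi)]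

lemma multilinearEval_shiftCoeff (t : V → R) (m : Finset V → R) (x : V → R) :
    multilinearEval (shiftCoeff t m) x = multilinearEval m (x + t) := by
  simp only [multilinearEval, shiftCoeff, Pi.add_apply, Finset.prod_add, Finset.sum_mul,
    Finset.mul_sum]
  rw [Finset.sum_comm' (t' := Finset.univ) (s' := Finset.powerset) (by simp)]
  refine Finset.sum_congr rfl fun f _ => Finset.sum_congr rfl fun e _ => ?_
  ring

lemma multilinearEval_eq_sum_erase (m : Finset V → R) (x : V → R) (v : V) :
    multilinearEval m x =
      ∑ e ∈ (Finset.univ.erase v).powerset, (m e + x v * m (insert v e)) * ∏ i ∈ e, x i := by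
  rw [multilinearEval, ← Finset.powerset_univ, ← Finset.insert_erase (Finset.mem_univ v),
    Finset.sum_powerset_insert (Finset.notMem_erase v _), ← Finset.sum_add_distrib,
    Finset.insert_erase (Finset.mem_univ v)]
  refine Finset.sum_congr rfl fun e he => ?_
  rw [Finset.prod_insert (Finset.subset_erase.1 (Finset.mem_powerset.1 he)).2]
  ring

lemma multilinearEval_restrictCoeff (m : Finset V → R) (x : V → R) (v : V) :
    multilinearEval (restrictCoeff v (x v) m) x = multilinearEval m x := by
  simp only [multilinearEval_eq_sum_erase _ x v]
  refine Finset.sum_congr rfl fun e he => ?_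
  have hv : v ∉ e := (Finset.subset_erase.1 (Finset.mem_powerset.1 he)).2
  simp [restrictCoeff, hv]

lemma exists_superset_ne_zero_of_shiftCoeff_ne_zero {t : V → R} {m : Finset V → R} {e : Finset V}
    (he : shiftCoeff t m e ≠ 0) : ∃ f, e ⊆ f ∧ m f ≠ 0 := by
  obtain ⟨f, hf, hne⟩ := Finset.exists_ne_zero_of_sum_ne_zero he
  exact ⟨f, (Finset.mem_filter.1 hf).2, left_ne_zero_of_mul hne⟩

omit [Fintype V] in
lemma notMem_of_restrictCoeff_ne_zero {v : V} {r : R} {m : Finset V → R} {e : Finset V}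
    (he : restrictCoeff v r m e ≠ 0) : v ∉ e :=
  fun hv => he (if_pos hv)

omit [Fintype V] in
lemma exists_superset_ne_zero_of_restrictCoeff_ne_zero {v : V} {r : R} {m : Finset V → R}
    {e : Finset V} (he : restrictCoeff v r m e ≠ 0) : ∃ f, e ⊆ f ∧ m f ≠ 0 := by
  by_contra! h
  refine he ?_
  simp [restrictCoeff, h e subset_rfl, h _ (Finset.subset_insert v e)]

lemma shiftCoeff_eq_self_of_maximal (t : V → R) {m : Finset V → R} {e : Finset V}
    (he : ∀ f, m f ≠ 0 → e ⊆ f → f = e) : shiftCoeff t m e = m e := by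
  rw [shiftCoeff, Finset.sum_eq_single_of_mem e (by simp)]
  · simp
  · intro f hf hfe
    rw [not_imp_comm.1 (fun hne => he f hne (Finset.mem_filter.1 hf).2) hfe, zero_mul]

lemma shiftCoeff_erase (t : V → R) {m : Finset V → R} {S : Finset V} {v : V} (hv : v ∈ S)
    (hm : ∀ e, m e ≠ 0 → e ⊆ S) :
    shiftCoeff t m (S.erase v) = m (S.erase v) + t v * m S := by
  have hne : S.erase v ≠ S := (Finset.erase_ssubset hv).ne
  have hzero : ∀ f, S.erase v ⊆ f → f ≠ S.erase v ∧ f ≠ S → m f = 0 := by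
    refine fun f hf hfS => not_imp_comm.1 (hm f) fun hfsub => ?_
    exact ((S.erase_wcovBy v).eq_or_eq hf hfsub).elim hfS.1 hfS.2
  rw [shiftCoeff, Finset.sum_eq_add_of_mem (S.erase v) S (by simp)
    (by simpa using S.erase_subset v) hne]
  · simp [Finset.sdiff_erase hv, mul_comm]
  · intro f hf hfS
    rw [hzero f (Finset.mem_filter.1 hf).2 hfS, zero_mul]

lemma exists_shiftCoeff_ne_zero {P : Finset V → Prop} (hP : Monotone P) (t : V → R)
    {m : Finset V → R} (hm : ∃ e, m e ≠ 0 ∧ P e) : ∃ e, shiftCoeff t m e ≠ 0 ∧ P e := by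
  obtain ⟨e, he⟩ := (Set.toFinite {e | m e ≠ 0 ∧ P e}).exists_maximal hm
  refine ⟨e, ?_, he.prop.2⟩
  rw [shiftCoeff_eq_self_of_maximal t fun f hf hef =>
    (he.le_of_ge ⟨hf, hP hef he.prop.2⟩ hef).antisymm hef]
  exact he.prop.1

lemma exists_shiftCoeff_erase_eq_zero_or_forall_ne {m : Finset V → R} {S : Finset V}
    (hm : ∀ e, m e ≠ 0 → e ⊆ S) :
    ∃ t : V → R, ∀ v ∈ S, shiftCoeff t m (S.erase v) = 0 ∨
      ∀ r, shiftCoeff t m (S.erase v) + r * shiftCoeff t m S ≠ 0 := by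
  have hchoice : ∀ v, ∃ c, m (S.erase v) + c * m S = 0 ∨ ∀ r, m (S.erase v) + r * m S ≠ 0 := by
    intro v
    by_cases h : ∃ c, m (S.erase v) + c * m S = 0
    · exact h.imp fun _ => Or.inl
    · exact ⟨0, Or.inr (not_exists.1 h)⟩
  choose t ht using hchoice
  refine ⟨t, fun v hv => ?_⟩
  rw [shiftCoeff_erase t hv hm,
    shiftCoeff_eq_self_of_maximal t fun f hf hSf => (hm f hf).antisymm hSf]
  refine (ht v).imp_right fun h r => ?_
  rw [add_assoc, ← add_mul]
  exact h _

omit [Fintype V] in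
lemma eq_or_exists_forall_restrictCoeff_ne_zero [Finite V] {P : Finset V → Prop}
    (hP : Monotone P) {m : Finset V → R} {S : Finset V} (hm : ∀ e, m e ≠ 0 → e ⊆ S)
    (hfacet : ∀ v ∈ S, m (S.erase v) = 0 ∨ ∀ r, m (S.erase v) + r * m S ≠ 0) :
    (∀ e, m e ≠ 0 → P e → e = S) ∨
      ∃ v ∈ S, ∃ e, P e ∧ ∀ r, restrictCoeff v r m e ≠ 0 := by
  refine or_iff_not_imp_left.2 fun hother => ?_
  push Not at hother
  obtain ⟨g, hg⟩ := (Set.toFinite {e | m e ≠ 0 ∧ P e ∧ e ≠ S}).exists_maximal hother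
  obtain ⟨hgm, hgP, hgS⟩ := hg.prop
  obtain ⟨v, hvS, hvg⟩ := Finset.exists_of_ssubset ((hm g hgm).ssubset_of_ne hgS)
  have hgv : g ⊆ insert v g := Finset.subset_insert v g
  suffices h : ∀ r, m g + r * m (insert v g) ≠ 0 from
    ⟨v, hvS, g, hgP, fun r => by simpa only [restrictCoeff, if_neg hvg] using h r⟩
  by_cases hins : insert v g = S
  · have hgerase : g = S.erase v := by rw [← hins, Finset.erase_insert hvg]
    rw [hins, hgerase]
    exact (hfacet v hvS).resolve_left (hgerase ▸ hgm)
  · have hzero : m (insert v g) = 0 := by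
      by_contra hne
      exact hvg (hg.le_of_ge ⟨hne, hP hgv hgP, hins⟩ hgv (Finset.mem_insert_self v g))
    simpa only [hzero, mul_zero, add_zero, forall_const] using hgm

end Polynomial

section Crossing

variable {V : Type*} [Fintype V] [DecidableEq V] {A e : Finset V}

lemma crosses_iff_not_subset : Crosses A e ↔ ¬ e ⊆ Aᶜ ∧ ¬ e ⊆ A := by
  simp only [Crosses, ← Finset.not_disjoint_iff_nonempty_inter, disjoint_compl_right_iff,
    le_compl_iff_disjoint_right]

lemma monotone_crosses (A : Finset V) : Monotone (Crosses A) := by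
  intro e f hef
  simp only [crosses_iff_not_subset]
  exact And.imp (mt hef.trans) (mt hef.trans)

lemma Crosses.two_le_card (h : Crosses A e) : 2 ≤ e.card := by
  obtain ⟨⟨i, hi⟩, ⟨j, hj⟩⟩ := h
  rw [Finset.mem_inter] at hi hj
  exact Finset.one_lt_card.2
    ⟨i, hi.1, j, hj.1, ne_of_mem_of_not_mem hi.2 (Finset.mem_compl.1 hj.2)⟩

lemma exists_eq_add_add_single {M : Type*} [AddZeroClass M] {S : Finset V} {m : Finset V → M}
    (hm : ∀ e, m e ≠ 0 → Crosses A e → e = S) :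
    ∃ mA mB : Finset V → M, (∀ e, mA e ≠ 0 → e ⊆ A) ∧ (∀ e, mB e ≠ 0 → e ⊆ Aᶜ) ∧
      m = mA + mB + Pi.single S (m S) := by
  refine ⟨fun e => if e ≠ S ∧ e ⊆ A then m e else 0,
    fun e => if e ≠ S ∧ ¬ e ⊆ A then m e else 0, fun e he => ?_, fun e he => ?_, ?_⟩
  · exact (ite_ne_right_iff.1 he).1.2
  · obtain ⟨⟨heS, heA⟩, hme⟩ := ite_ne_right_iff.1 he
    by_contra heB
    exact heS (hm e hme (crosses_iff_not_subset.2 ⟨heB, heA⟩))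
  · ext e
    by_cases heS : e = S <;> by_cases heA : e ⊆ A <;> simp [heS, heA]

end Crossing

section LocalUnitary

variable {d : ℕ} [NeZero d] {V : Type*} [Fintype V] [DecidableEq V]

lemma act_diagonal_apply (D : (V → ZMod d) → ℂ) (ψ : Space d V) (x : V → ZMod d) :
    act (Matrix.diagonal D) ψ x = D x * ψ x := by
  simp [act, Matrix.toLpLin_apply, Matrix.mulVec_diagonal]

lemma act_permMatrix_apply (σ : Equiv.Perm (V → ZMod d)) (ψ : Space d V) (x : V → ZMod d) :
    act (σ.permMatrix ℂ) ψ x = ψ (σ x) := by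
  simp [act, Matrix.toLpLin_apply, Matrix.permMatrix_mulVec]

lemma permMatrix_mem_unitaryGroup {R ι : Type*} [CommRing R] [StarRing R] [Fintype ι]
    [DecidableEq ι] (σ : Equiv.Perm ι) : σ.permMatrix R ∈ Matrix.unitaryGroup ι R := by
  rw [Matrix.mem_unitaryGroup_iff, Matrix.star_eq_conjTranspose, Matrix.conjTranspose_permMatrix,
    ← Matrix.permMatrix_mul, inv_mul_cancel, Matrix.permMatrix_one]

lemma diagonal_mem_unitaryGroup {ι : Type*} [Fintype ι] [DecidableEq ι] {D : ι → ℂ}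
    (hD : ∀ x, ‖D x‖ = 1) : Matrix.diagonal D ∈ Matrix.unitaryGroup ι ℂ := by
  rw [Matrix.mem_unitaryGroup_iff, Matrix.star_eq_conjTranspose, Matrix.diagonal_conjTranspose,
    Matrix.diagonal_mul_diagonal, ← Matrix.diagonal_one]
  congr 1
  ext x
  simp [Complex.mul_conj', hD x]

lemma restrict_eq_and_restrict_compl_eq_iff {α : Type*} (A : Finset V) {x y : V → α} :
    ((fun i : {i // i ∈ A} => x i) = fun i : {i // i ∈ A} => y i) ∧
      ((fun i : {i // i ∈ Aᶜ} => x i) = fun i : {i // i ∈ Aᶜ} => y i) ↔ x = y := by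
  simp only [funext_iff, Subtype.forall, Finset.mem_compl]
  exact ⟨fun h i => (em (i ∈ A)).elim (h.1 i) (h.2 i), fun h => ⟨fun i _ => h i, fun i _ => h i⟩⟩

lemma isLocalUnitary_shift (A : Finset V) (t : V → ZMod d) :
    IsLocalUnitary A ((Equiv.addRight t).permMatrix ℂ) := by
  refine ⟨(Equiv.addRight fun i : {i // i ∈ A} => t i).permMatrix ℂ,
    permMatrix_mem_unitaryGroup _, (Equiv.addRight fun i : {i // i ∈ Aᶜ} => t i).permMatrix ℂ,
    permMatrix_mem_unitaryGroup _, fun x y => ?_⟩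
  simp only [PEquiv.toMatrix_apply, Equiv.toPEquiv_apply, Equiv.coe_addRight, Option.mem_some_iff,
    ite_zero_mul_ite_zero, mul_one]
  exact if_congr (restrict_eq_and_restrict_compl_eq_iff A (x := x + t)).symm rfl rfl

lemma isLocalUnitary_diagonal {A : Finset V} {F G : (V → ZMod d) → ZMod d}
    (hF : DependsOn F (A : Set V)) (hG : DependsOn G (Aᶜ : Finset V)) :
    IsLocalUnitary A (Matrix.diagonal fun x => ZMod.stdAddChar (F x + G x)) := by
  obtain ⟨a, rfl⟩ := dependsOn_iff_exists_comp.1 hF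
  obtain ⟨b, rfl⟩ := dependsOn_iff_exists_comp.1 hG
  refine ⟨Matrix.diagonal fun y => ZMod.stdAddChar (a y),
    diagonal_mem_unitaryGroup fun y => AddChar.norm_apply _ _,
    Matrix.diagonal fun y => ZMod.stdAddChar (b y),
    diagonal_mem_unitaryGroup fun y => AddChar.norm_apply _ _, fun x y => ?_⟩
  simp only [Matrix.diagonal_apply, ite_zero_mul_ite_zero,
    restrict_eq_and_restrict_compl_eq_iff A, AddChar.map_add_eq_mul]
  rfl

end LocalUnitary

section PhaseState

variable {d : ℕ} [NeZero d] {V : Type*} [Fintype V] [DecidableEq V]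

/-- The state in which the active qudits, those in `S`, are in a superposition with equal weights
and with phases `ω ^ F x`, and every qudit `i ∉ S` is in the basis state `|q i⟩`. The protocol only
passes through such states. The values of `q` on `S` are irrelevant. -/
def phaseState (S : Finset V) (F : (V → ZMod d) → ZMod d) (q : V → ZMod d) : Space d V :=
  WithLp.toLp 2 fun x =>
    if ∀ i ∉ S, x i = q i then (Real.sqrt d : ℂ)⁻¹ ^ S.card * ZMod.stdAddChar (F x) else 0

lemma phaseState_apply (S : Finset V) (F : (V → ZMod d) → ZMod d) (q x : V → ZMod d) :
    phaseState S F q x =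
      if ∀ i ∉ S, x i = q i then (Real.sqrt d : ℂ)⁻¹ ^ S.card * ZMod.stdAddChar (F x) else 0 :=
  rfl

lemma phaseState_congr {S : Finset V} {F G : (V → ZMod d) → ZMod d} {q : V → ZMod d}
    (h : ∀ x, (∀ i ∉ S, x i = q i) → F x = G x) : phaseState S F q = phaseState S G q := by
  ext x
  rw [phaseState_apply, phaseState_apply]
  exact ite_congr rfl (fun hx => by rw [h x hx]) fun _ => rfl

lemma card_filter_forall_notMem_eq {α : Type*} [Fintype α] [DecidableEq α] (S : Finset V)
    (q : V → α) :
    (Finset.univ.filter fun x : V → α => ∀ i ∉ S, x i = q i).card = Fintype.card α ^ S.card := by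
  have hpi : (Finset.univ.filter fun x : V → α => ∀ i ∉ S, x i = q i) =
      Fintype.piFinset fun i => if i ∈ S then Finset.univ else {q i} := by
    ext x
    simp only [Finset.mem_filter, Finset.mem_univ, true_and, Fintype.mem_piFinset]
    refine forall_congr' fun i => ?_
    by_cases hi : i ∈ S <;> simp [hi]
  simp [hpi, Fintype.card_piFinset, apply_ite Finset.card, Finset.prod_ite_mem]

lemma norm_phaseState (S : Finset V) (F : (V → ZMod d) → ZMod d) (q : V → ZMod d) :
    ‖phaseState S F q‖ = 1 := by
  have hd : (d : ℝ) ≠ 0 := Nat.cast_ne_zero.2 (NeZero.ne d)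
  have hsq : ∀ x, ‖phaseState S F q x‖ ^ 2 =
      if ∀ i ∉ S, x i = q i then (d : ℝ)⁻¹ ^ S.card else 0 := by
    intro x
    rw [phaseState_apply]
    split_ifs
    · rw [norm_mul, AddChar.norm_apply, mul_one, norm_pow, norm_inv, Complex.norm_real,
        Real.norm_of_nonneg (Real.sqrt_nonneg _), pow_right_comm, inv_pow,
        Real.sq_sqrt (Nat.cast_nonneg d)]
    · simp
  rw [EuclideanSpace.norm_eq, Real.sqrt_eq_one]
  simp only [hsq]
  rw [← Finset.sum_filter, Finset.sum_const, card_filter_forall_notMem_eq, ZMod.card, nsmul_eq_mul,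
    Nat.cast_pow, ← mul_pow, mul_inv_cancel₀ hd, one_pow]

lemma postMeasurement_eq_of_act_proj_eq_smul {v : V} {r : ZMod d} {ψ φ : Space d V} {c : ℝ}
    (hc : 0 < c) (hφ : ‖φ‖ = 1) (h : act (proj v r) ψ = (c : ℂ) • φ) :
    postMeasurement v r ψ = φ := by
  rw [postMeasurement, h, norm_smul, hφ, mul_one, Complex.norm_of_nonneg hc.le, smul_smul,
    ← Complex.ofReal_mul, inv_mul_cancel₀ hc.ne', Complex.ofReal_one, one_smul]

omit [Fintype V] in
lemma forall_notMem_erase_eq_update_iff {α : Type*} {S : Finset V} {v : V} (hv : v ∈ S)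
    {x q : V → α} {r : α} :
    (∀ i ∉ S.erase v, x i = Function.update q v r i) ↔ x v = r ∧ ∀ i ∉ S, x i = q i := by
  simp only [Finset.mem_erase, not_and_or, not_ne_iff, or_imp, forall_and, forall_eq,
    Function.update_self]
  refine and_congr_right fun _ => forall₂_congr fun i hi => ?_
  rw [Function.update_of_ne (ne_of_mem_of_not_mem hv hi).symm]

lemma act_proj_phaseState {S : Finset V} {v : V} (hv : v ∈ S) (F : (V → ZMod d) → ZMod d)
    (q : V → ZMod d) (r : ZMod d) :
    act (proj v r) (phaseState S F q) =
      (((Real.sqrt d)⁻¹ : ℝ) : ℂ) • phaseState (S.erase v) F (Function.update q v r) := by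
  ext x
  simp only [proj, act_diagonal_apply, PiLp.smul_apply, smul_eq_mul, phaseState_apply,
    forall_notMem_erase_eq_update_iff hv, ite_zero_mul_ite_zero]
  rw [mul_ite, mul_zero]
  refine if_congr Iff.rfl ?_ rfl
  rw [← Finset.card_erase_add_one hv, pow_succ', Complex.ofReal_inv]
  ring

lemma postMeasurement_phaseState {S : Finset V} {v : V} (hv : v ∈ S)
    (m : Finset V → ZMod d) (q : V → ZMod d) (r : ZMod d) :
    postMeasurement v r (phaseState S (multilinearEval m) q) =
      phaseState (S.erase v) (multilinearEval (restrictCoeff v r m)) (Function.update q v r) := by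
  have hd : 0 < (Real.sqrt d)⁻¹ := inv_pos.2 (Real.sqrt_pos.2 (Nat.cast_pos.2 (NeZero.pos d)))
  rw [postMeasurement_eq_of_act_proj_eq_smul hd (norm_phaseState _ _ _)
    (act_proj_phaseState hv _ q r)]
  refine phaseState_congr fun x hx => ?_
  rw [← ((forall_notMem_erase_eq_update_iff hv).1 hx).1, multilinearEval_restrictCoeff]

lemma act_shift_phaseState (S : Finset V) (t : V → ZMod d) (m : Finset V → ZMod d)
    (q : V → ZMod d) :
    act ((Equiv.addRight t).permMatrix ℂ) (phaseState S (multilinearEval m) q) =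
      phaseState S (multilinearEval (shiftCoeff t m)) (q - t) := by
  ext x
  simp only [act_permMatrix_apply, phaseState_apply, Equiv.coe_addRight,
    multilinearEval_shiftCoeff, Pi.add_apply, Pi.sub_apply, eq_sub_iff_add_eq]

lemma act_diagonal_phaseState (S : Finset V) (F G : (V → ZMod d) → ZMod d) (q : V → ZMod d) :
    act (Matrix.diagonal fun x => ZMod.stdAddChar (F x)) (phaseState S G q) =
      phaseState S (F + G) q := by
  ext x
  simp only [act_diagonal_apply, phaseState_apply, Pi.add_apply, AddChar.map_add_eq_mul, mul_ite,
    mul_zero, mul_left_comm]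

omit [Fintype V] [DecidableEq V] in
lemma phase_pow_val (e : Finset V) (μ : ZMod d) (x : V → ZMod d) :
    (phase e ^ μ.val) x = ZMod.stdAddChar (μ * ∏ i ∈ e, x i) := by
  rw [Pi.pow_apply, phase, ← AddChar.map_nsmul_eq_pow, nsmul_eq_mul, ZMod.natCast_zmod_val]

lemma addChar_map_sum {ι G M : Type*} [AddCommMonoid G] [CommMonoid M] (ψ : AddChar G M)
    (s : Finset ι) (f : ι → G) : ψ (∑ i ∈ s, f i) = ∏ i ∈ s, ψ (f i) :=
  map_prod ψ.toMonoidHom (fun i => Multiplicative.ofAdd (f i)) s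

lemma hypergraphState_eq_phaseState (H : MultiHypergraph d V) (q : V → ZMod d) :
    hypergraphState H = phaseState Finset.univ (multilinearEval H.mult) q := by
  ext x
  simp only [hypergraphState, act_diagonal_apply, plus, Finset.prod_apply, phase_pow_val,
    phaseState_apply, multilinearEval, addChar_map_sum, Finset.mem_univ, not_true_eq_false,
    IsEmpty.forall_iff, implies_true, if_true, Finset.card_univ, mul_comm]

lemma tensorBasis_elementaryState (S : Finset V) (μ : ZMod d) (q : V → ZMod d) :
    tensorBasis S (elementaryState {i // i ∈ S} μ) q =
      phaseState S (multilinearEval (Pi.single S μ)) q := by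
  ext x
  simp only [tensorBasis, elementaryState, act_diagonal_apply, phase_pow_val, phaseState_apply,
    plus, multilinearEval_single, Fintype.card_coe, Finset.prod_coe_sort S x,
    Finset.prod_ite_zero, Finset.prod_const_one, Finset.mem_compl]
  rw [mul_ite, mul_one, mul_zero]
  refine if_congr Iff.rfl (mul_comm _ _) rfl

end PhaseState

section Protocol

variable {d : ℕ} [NeZero d] {V : Type*} [Fintype V] [DecidableEq V] {A S : Finset V} {K : ℕ}
  {m : Finset V → ZMod d}

lemma reduces_phaseState_of_unique_crossing (q : V → ZMod d) (hK : S.card ≤ K) (hS : Crosses A S)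
    (hmS : m S ≠ 0) (huniq : ∀ e, m e ≠ 0 → Crosses A e → e = S) :
    Reduces A (elementaryTargets A K) (phaseState S (multilinearEval m) q) := by
  obtain ⟨mA, mB, hmA, hmB, hm⟩ := exists_eq_add_add_single huniq
  have hU := isLocalUnitary_diagonal
    (fun x y hxy => congrArg Neg.neg (dependsOn_multilinearEval hmA hxy))
    (fun x y hxy => congrArg Neg.neg (dependsOn_multilinearEval hmB hxy))
  refine .unitary _ _ hU (.done _ ⟨S.card, m S, S, q, hS.two_le_card, hK, hmS, rfl, hS, ?_⟩)
  rw [tensorBasis_elementaryState, act_diagonal_phaseState]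
  congr 1
  ext x
  conv_lhs => rw [hm]
  simp only [multilinearEval_add, Pi.add_apply]
  ring

theorem reduces_phaseState (q : V → ZMod d) (hsub : ∀ e, m e ≠ 0 → e ⊆ S)
    (hK : ∀ e, m e ≠ 0 → e.card ≤ K) (hcross : ∃ e, m e ≠ 0 ∧ Crosses A e) :
    Reduces A (elementaryTargets A K) (phaseState S (multilinearEval m) q) := by
  induction S using Finset.strongInduction generalizing m q with
  | H S ih =>
  obtain ⟨t, hfacet⟩ := exists_shiftCoeff_erase_eq_zero_or_forall_ne hsub
  replace hcross := exists_shiftCoeff_ne_zero (monotone_crosses A) t hcross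
  have hsub' : ∀ e, shiftCoeff t m e ≠ 0 → e ⊆ S := fun e he =>
    have ⟨f, hef, hf⟩ := exists_superset_ne_zero_of_shiftCoeff_ne_zero he
    hef.trans (hsub f hf)
  have hK' : ∀ e, shiftCoeff t m e ≠ 0 → e.card ≤ K := fun e he =>
    have ⟨f, hef, hf⟩ := exists_superset_ne_zero_of_shiftCoeff_ne_zero he
    (Finset.card_le_card hef).trans (hK f hf)
  refine .unitary _ _ (isLocalUnitary_shift A t) ?_
  rw [act_shift_phaseState]
  rcases eq_or_exists_forall_restrictCoeff_ne_zero (monotone_crosses A) hsub' hfacet with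
    huniq | ⟨v, hv, e, he, hne⟩
  · obtain ⟨e, hme, he⟩ := hcross
    obtain rfl := huniq e hme he
    exact reduces_phaseState_of_unique_crossing _ (hK' e hme) he hme huniq
  · refine .measure _ v fun r _ => ?_
    rw [postMeasurement_phaseState hv]
    refine ih _ (Finset.erase_ssubset hv) _ (fun f hf => ?_) (fun f hf => ?_) ⟨e, hne r, he⟩
    · obtain ⟨g, hfg, hg⟩ := exists_superset_ne_zero_of_restrictCoeff_ne_zero hf
      exact Finset.subset_erase.2 ⟨hfg.trans (hsub' g hg), notMem_of_restrictCoeff_ne_zero hf⟩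
    · obtain ⟨g, hfg, hg⟩ := exists_superset_ne_zero_of_restrictCoeff_ne_zero hf
      exact (Finset.card_le_card hfg).trans (hK' g hg)

end Protocol

end Qudit

namespace MultiHypergraph

variable {d : ℕ} {V : Type*} [Fintype V] {H : MultiHypergraph d V}

lemma IsConnected.exists_isEdge_crosses [DecidableEq V] (hH : H.IsConnected) {A : Finset V}
    (hA : A.Nonempty) (hB : Aᶜ.Nonempty) : ∃ e, H.IsEdge e ∧ Qudit.Crosses A e := by
  obtain ⟨a, ha⟩ := hA
  obtain ⟨b, hb⟩ := hB
  obtain ⟨w⟩ := hH.preconnected a b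
  obtain ⟨p, -, hpA, hpB⟩ := w.exists_boundary_dart A ha (Finset.mem_compl.1 hb)
  obtain ⟨-, e, he, hfst, hsnd⟩ := p.adj
  exact ⟨e, he, ⟨_, Finset.mem_inter.2 ⟨hfst, hpA⟩⟩,
    ⟨_, Finset.mem_inter.2 ⟨hsnd, Finset.mem_compl.2 hpB⟩⟩⟩

lemma IsEdge.card_le_maxCard {e : Finset V} (he : H.IsEdge e) : e.card ≤ H.maxCard := by
  classical
  exact Finset.le_sup (f := Finset.card) (by simpa using he)

end MultiHypergraph

end

theorem mainTheorem4_general {d : ℕ} [NeZero d] {V : Type*} [Fintype V] [DecidableEq V]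
    (H : MultiHypergraph d V) (A : Finset V) (hcross : ∃ e, H.IsEdge e ∧ Qudit.Crosses A e) :
    Qudit.Reduces A (Qudit.elementaryTargets A H.maxCard) (Qudit.hypergraphState H) := by
  rw [Qudit.hypergraphState_eq_phaseState H 0]
  exact Qudit.reduces_phaseState 0 (fun e _ => e.subset_univ)
    (fun _ he => MultiHypergraph.IsEdge.card_le_maxCard he) hcross

theorem mainTheorem4 (d n : ℕ) [NeZero d] (hd : 2 ≤ d)
    (H : MultiHypergraph d (Fin n)) (hH : H.IsConnected)
    (A : Finset (Fin n)) (hA : A.Nonempty) (hB : Aᶜ.Nonempty) :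
    Qudit.Reduces A (Qudit.elementaryTargets A H.maxCard) (Qudit.hypergraphState H) :=
  mainTheorem4_general H A (hH.exists_isEdge_crosses hA hB)
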